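/- Let $k\in\mathbb N$, equip $\mathbb R^k$ and $\mathbb C^k$ with the uniform norm $|z|=\max_{j}|z_j|$, and write $z=x+iy$ with $x,y\in\mathbb R^k$ for $z\in\mathbb C^k$. Let $A,B>0$, let $U$ be a nonempty cone in $\mathbb R^k$ (a set with $tx\in U$ for all $x\in U$, $t>0$), let $\alpha$ be a continuous nondecreasing real function on $[0,\infty)$, and let $\beta$ be a continuous convex nondecreasing real function on $[0,\infty)$. For a nonempty cone $V\subset\mathbb R^k$ and $a,b>0$ set $$\rho_{V,a,b}(x+iy)=-\alpha(|x/a|)+\beta(b|y|)+\beta(b\,\delta_V(x)),\qquad \delta_V(x)=\inf_{x'\in V}|x-x'|.$$ Suppose that for some $A_0,B_0>0$ there is an entire function $\varphi$ on $\mathbb C$, not identically zero, with $$|\varphi(z)|\le e^{\beta(B_0|y|)-\alpha(|x/A_0|)},\qquad z=x+iy\in\mathbb C.$$ Put $B'=(2ek+1)B+4kA_0B_0/A$, and let $A'=2A$; if $\alpha$ is concave, one may also take $A'=A$. Then: 1. There is a constant $H$ such that for every $R>0$ there exists a plurisubharmonic function $\rho_R\colon\mathbb C^k\to[-\infty,\infty)$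 with $$\rho_R(z)\le\rho_{\mathbb R^k,A',B'}(z)+\beta(2BeR)\quad\text{and}\quad \rho_R(z)\le\rho_{U,A',B'}(z)\qquad\text{for all } z\in\mathbb C^k,$$ $$\rho_R(z)\ge\rho_{U,A,B}(z)-H\qquad\text{for all } z=x+iy\in\mathbb C^k\text{ with }|x|\le R.$$ In particular, $H$ does not depend on $R$. 2. There are a constant $H$ and a plurisubharmonic function $\rho\colon\mathbb C^k\to[-\infty,\infty)$ such that $$\rho_{U,A,B}(z)-H\le\rho(z)\le\rho_{U,A',B'}(z)\qquad\text{for all } z\in\mathbb C^k.$$ -/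

import Mathlib

noncomputable section

namespace PshApprox

/-- The mean `(1 / 2π) ∫₀^{2π} f (z + e^{iθ} w) dθ`, with values in `[-∞, ∞]`, of a function `f` on
`ℂ^k` that is bounded above on the circle: the infimum (equivalently, the limit) of the means of the
truncations `max (f, -n)`, which are bounded functions on the circle when `f` is upper
semicontinuous and `f < ∞`. -/
def circleMean {k : ℕ} (f : (Fin k → ℂ) → EReal) (z w : Fin k → ℂ) : EReal :=
  ⨅ n : ℕ, ((Real.circleAverage
    (fun ζ : ℂ => (max (f (z + ζ • w)) ((-(n : ℝ) : ℝ) : EReal)).toReal) 0 1 : ℝ) : EReal)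

/-- Plurisubharmonic functions on `ℂ^k`: upper semicontinuous functions with values in `[-∞, ∞)`
that satisfy the sub-mean value inequality on every circle of every complex line. The function that
is identically `-∞` is included. -/
structure IsPlurisubharmonic {k : ℕ} (f : (Fin k → ℂ) → EReal) : Prop where
  upperSemicontinuous : UpperSemicontinuous f
  ne_top : ∀ z, f z ≠ ⊤
  le_circleMean : ∀ z w, f z ≤ circleMean f z w

/-- A cone in `ℝ^k`: a set that is stable under multiplication by positive numbers. It need not be
convex, open or closed, and it may or may not contain the origin. -/
def IsCone {k : ℕ} (U : Set (Fin k → ℝ)) : Prop :=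
  ∀ x ∈ U, ∀ t : ℝ, 0 < t → t • x ∈ U

/-- The real part `x` of `z = x + i y ∈ ℂ^k`. -/
def rePart {k : ℕ} (z : Fin k → ℂ) : Fin k → ℝ := fun j => (z j).re

/-- The imaginary part `y` of `z = x + i y ∈ ℂ^k`. -/
def imPart {k : ℕ} (z : Fin k → ℂ) : Fin k → ℝ := fun j => (z j).im

/-- `ρ_{U,A,B}(x + i y) = -α(|x / A|) + β(B |y|) + β(B δ_U(x))`. The norm of `Fin k → ℝ` is the
uniform norm `max_j |x_j|`, and `Metric.infDist` is the distance for this norm. -/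
def rho {k : ℕ} (α β : ℝ → ℝ) (U : Set (Fin k → ℝ)) (A B : ℝ) (z : Fin k → ℂ) : ℝ :=
  -α (‖rePart z‖ / A) + β (B * ‖imPart z‖) + β (B * Metric.infDist (rePart z) U)

end PshApprox

end

noncomputable section

open Filter Topology MeasureTheory Real

namespace PshApprox

/-! After normalizing `α 0 = β 0 = 0`, the function sought is the upper semicontinuous
regularization of the supremum of blocks `localBlock`, indexed by real points `ξ` and shifts `η`. A
block adds constants, convex functions of `|y|` and two sums of logarithms of moduli of entire
functions.

The first sum localizes near `ξ`. Put `r = δ_U(ξ)`, `s = B r`, let `t` be a subgradient of `β` at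
`s`, and use `t s log |sinc (2e (z_j - ξ_j) / r)|`. Since `log |sinc w| ≤ |Im w|`, the sum is at
most `t u` with `u = 2ekB|y|`. If `|x - ξ| ≥ r/2`, some `w` has `|Re w| ≥ e`, which saves `t s`, and
`β s + t (u - s) ≤ β u` removes `β s` altogether. If `|x - ξ| < r/2`, then `r ≤ 2 δ_U(x)`, and the
excess `β (2s)` is absorbed by `β (B' δ_U(x))`. This is `localized_le`.

The second sum uses translates of `φ` and supplies `-α (|x - ξ| / A)`, which with `-α (|ξ| / A)`
bounds `-α (|x| / A')` from above in reverse: `α (|x| / A')` is at most the sum of the two values of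
`α`. The shift `η` puts the argument of `φ`, at a prescribed `ξ + iy`, at a fixed point of the
imaginary axis where `φ ≠ 0`. Convexity of `β` separates `y` from `η` (`sum_log_norm_translate_le`).

At `ξ + iy` each `sinc` has modulus at least 1, so the block with the right `η` loses only a
constant there. This constant depends neither on `ξ` nor on `y`, hence not on `R`. -/

/-! ### Circle means of upper semicontinuous functions. -/

/-- An upper semicontinuous function on a finite-dimensional space that is bounded below is
integrable on circles of complex lines. -/
theorem circleIntegrable_of_upperSemicontinuous {k : ℕ} {g : (Fin k → ℂ) → ℝ}
    (hg : UpperSemicontinuous g) {m : ℝ} (hm : ∀ x, m ≤ g x) (z w : Fin k → ℂ) :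
    CircleIntegrable (fun ζ : ℂ => g (z + ζ • w)) 0 1 := by
  have hc : Continuous fun θ : ℝ => z + circleMap 0 1 θ • w := by fun_prop
  have hK : IsCompact ((fun θ : ℝ => z + circleMap 0 1 θ • w) '' Set.uIcc 0 (2 * π)) :=
    isCompact_uIcc.image hc
  obtain ⟨M, hM⟩ := UpperSemicontinuousOn.bddAbove_of_isCompact hK (hg.upperSemicontinuousOn _)
  have hmeas : Measurable fun θ : ℝ => g (z + circleMap 0 1 θ • w) :=
    hg.measurable.comp hc.measurable
  unfold CircleIntegrable
  rw [intervalIntegrable_iff]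
  refine Measure.integrableOn_of_bounded (M := max |m| |M|) measure_Ioc_lt_top.ne
    hmeas.aestronglyMeasurable ?_
  filter_upwards [ae_restrict_mem measurableSet_uIoc] with θ hθ
  have h1 : g (z + circleMap 0 1 θ • w) ≤ M :=
    hM ⟨_, ⟨θ, Set.uIoc_subset_uIcc hθ, rfl⟩, rfl⟩
  rw [Real.norm_eq_abs]
  exact abs_le_max_abs_abs (hm _) h1

/-- Circle means of an upper semicontinuous function that is bounded below depend upper
semicontinuously on the centre. -/
theorem upperSemicontinuous_circleAverage {k : ℕ} {g : (Fin k → ℂ) → ℝ}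
    (hg : UpperSemicontinuous g) {m : ℝ} (hm : ∀ x, m ≤ g x) (w : Fin k → ℂ) :
    UpperSemicontinuous fun z => circleAverage (fun ζ : ℂ => g (z + ζ • w)) 0 1 := by
  intro z₀ c hc
  have hK : IsCompact ((fun p : (Fin k → ℂ) × ℝ => p.1 + circleMap 0 1 p.2 • w) ''
      (Metric.closedBall z₀ 1 ×ˢ Set.uIcc 0 (2 * π))) :=
    ((isCompact_closedBall z₀ 1).prod isCompact_uIcc).image (by fun_prop)
  obtain ⟨M₀, hM⟩ := UpperSemicontinuousOn.bddAbove_of_isCompact hK (hg.upperSemicontinuousOn _)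
  -- Fatou's lemma is applied to `M - g ≥ 0`. The extra 1 makes its integral strictly positive, so
  -- that strict inequalities survive `ENNReal.ofReal`.
  set M := M₀ + 1 with hMdef
  set I : Set ℝ := Set.Ioc 0 (2 * π) with hI
  have h2π : (0 : ℝ) ≤ 2 * π := by positivity
  have hMle : ∀ z ∈ Metric.closedBall z₀ 1, ∀ θ ∈ I, g (z + circleMap 0 1 θ • w) ≤ M₀ := by
    intro z hz θ hθ
    refine hM ⟨_, ⟨(z, θ), ⟨hz, ?_⟩, rfl⟩, rfl⟩
    rw [Set.uIcc_of_le h2π]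
    exact Set.Ioc_subset_Icc_self hθ
  have hmeas : ∀ z, Measurable fun θ : ℝ => g (z + circleMap 0 1 θ • w) := fun z =>
    hg.measurable.comp (by fun_prop : Continuous _).measurable
  have hint : ∀ z, IntegrableOn (fun θ : ℝ => g (z + circleMap 0 1 θ • w)) I := by
    intro z
    have := circleIntegrable_of_upperSemicontinuous hg hm z w
    unfold CircleIntegrable at this
    rwa [intervalIntegrable_iff_integrableOn_Ioc_of_le h2π] at this
  have hav : ∀ z, circleAverage (fun ζ : ℂ => g (z + ζ • w)) 0 1
      = (2 * π)⁻¹ * ∫ θ in I, g (z + circleMap 0 1 θ • w) := by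
    intro z
    rw [circleAverage_def, intervalIntegral.integral_of_le h2π, smul_eq_mul]
  have hcompl : ∀ z ∈ Metric.closedBall z₀ 1,
      ∫⁻ θ in I, ENNReal.ofReal (M - g (z + circleMap 0 1 θ • w))
        = ENNReal.ofReal (2 * π * M - ∫ θ in I, g (z + circleMap 0 1 θ • w)) := by
    intro z hz
    rw [← ofReal_integral_eq_lintegral_ofReal]
    · rw [integral_sub (integrable_const _) (hint z)]
      simp [hI, h2π]
    · exact (integrable_const _).sub (hint z)
    · filter_upwards [ae_restrict_mem measurableSet_Ioc] with θ hθ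
      have := hMle z hz θ hθ
      simp only [Pi.zero_apply]
      linarith
  have hfatou := lintegral_liminf_le (μ := volume.restrict I) (u := 𝓝 z₀)
    (f := fun z θ => ENNReal.ofReal (M - g (z + circleMap 0 1 θ • w)))
    (fun z => (measurable_const.sub (hmeas z)).ennreal_ofReal)
  have hlow : ∫⁻ θ in I, ENNReal.ofReal (M - g (z₀ + circleMap 0 1 θ • w))
      ≤ ∫⁻ θ in I, liminf (fun z => ENNReal.ofReal (M - g (z + circleMap 0 1 θ • w))) (𝓝 z₀) := by
    refine lintegral_mono fun θ => ?_
    suffices LowerSemicontinuousAt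
      (fun z => ENNReal.ofReal (M - g (z + circleMap 0 1 θ • w))) z₀ from this.le_liminf
    have hu : UpperSemicontinuousAt (fun z => g (z + circleMap 0 1 θ • w)) z₀ :=
      UpperSemicontinuousAt.comp (f := g) (g := fun z => z + circleMap 0 1 θ • w) (hg _)
        (by fun_prop)
    refine ContinuousAt.comp_upperSemicontinuousAt_antitone
      (g := fun t : ℝ => ENNReal.ofReal (M - t)) ?_ hu ?_
    · exact (ENNReal.continuous_ofReal.comp (continuous_const.sub continuous_id)).continuousAt
    · intro a b hab
      exact ENNReal.ofReal_le_ofReal (by linarith)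
  have hle := hlow.trans hfatou
  rw [hcompl z₀ (Metric.mem_closedBall_self zero_le_one)] at hle
  have hpos : 0 < 2 * π * M - ∫ θ in I, g (z₀ + circleMap 0 1 θ • w) := by
    have h1 : ∫ θ in I, g (z₀ + circleMap 0 1 θ • w) ≤ ∫ θ in I, M₀ :=
      setIntegral_mono_on (hint z₀) (integrable_const _) measurableSet_Ioc
        fun θ hθ => hMle z₀ (Metric.mem_closedBall_self zero_le_one) θ hθ
    have h2 : ∫ θ in I, M₀ = 2 * π * M₀ := by simp [hI, h2π]
    have := Real.pi_pos
    rw [hMdef]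
    nlinarith
  have hlt : ENNReal.ofReal (2 * π * M - 2 * π * c)
      < ENNReal.ofReal (2 * π * M - ∫ θ in I, g (z₀ + circleMap 0 1 θ • w)) := by
    rw [ENNReal.ofReal_lt_ofReal_iff hpos]
    have h1 : (2 * π)⁻¹ * ∫ θ in I, g (z₀ + circleMap 0 1 θ • w) < c := by
      rw [← hav]; exact hc
    rw [inv_mul_lt_iff₀ (by positivity)] at h1
    linarith
  filter_upwards [eventually_lt_of_lt_liminf (hlt.trans_le hle),
    Metric.closedBall_mem_nhds z₀ one_pos] with z hz hzb
  rw [hcompl z hzb] at hz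
  have h1 := (ENNReal.ofReal_lt_ofReal_iff'.1 hz).1
  show circleAverage (fun ζ : ℂ => g (z + ζ • w)) 0 1 < c
  rw [hav, inv_mul_lt_iff₀ (by positivity)]
  linarith

/-! ### Suprema and regularization of functions with the sub-mean value property. -/

/-- The value of `f` at each point is at most the circle means of every upper semicontinuous
majorant of `f` that is bounded below. -/
def SubMean {k : ℕ} (f : (Fin k → ℂ) → EReal) : Prop :=
  ∀ (g : (Fin k → ℂ) → ℝ) (m : ℝ), UpperSemicontinuous g → (∀ x, m ≤ g x) →
    (∀ x, f x ≤ (g x : EReal)) → ∀ z w : Fin k → ℂ,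
      f z ≤ (circleAverage (fun ζ : ℂ => g (z + ζ • w)) 0 1 : ℝ)

/-- A majorant of the supremum majorizes every member. Testing against majorants avoids
measurability of an uncountable supremum. -/
theorem SubMean.iSup {k : ℕ} {ι : Type*} {F : ι → (Fin k → ℂ) → EReal}
    (h : ∀ i, SubMean (F i)) : SubMean fun z => ⨆ i, F i z :=
  fun g m hg hm hle z w => iSup_le fun i =>
    h i g m hg hm (fun x => (le_iSup (fun i => F i x) i).trans (hle x)) z w

/-- The upper semicontinuous regularization. -/
def uscReg {k : ℕ} (f : (Fin k → ℂ) → EReal) (z : Fin k → ℂ) : EReal :=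
  limsup f (𝓝 z)

theorem le_uscReg {k : ℕ} (f : (Fin k → ℂ) → EReal) (z : Fin k → ℂ) : f z ≤ uscReg f z := by
  rw [uscReg, le_limsup_iff]
  intro y hy
  exact frequently_iff.2 fun hU => ⟨z, mem_of_mem_nhds hU, hy⟩

theorem uscReg_le {k : ℕ} {f g : (Fin k → ℂ) → EReal} (hg : UpperSemicontinuous g)
    (h : ∀ z, f z ≤ g z) (z : Fin k → ℂ) : uscReg f z ≤ g z :=
  (limsup_le_limsup (Eventually.of_forall h)).trans (UpperSemicontinuousAt.limsup_le (hg z))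

theorem upperSemicontinuous_uscReg {k : ℕ} (f : (Fin k → ℂ) → EReal) :
    UpperSemicontinuous (uscReg f) := by
  intro z c hc
  obtain ⟨b, hb, hbc⟩ := exists_between hc
  have h1 : ∀ᶠ z' in 𝓝 z, f z' < b := eventually_lt_of_limsup_lt hb
  filter_upwards [eventually_eventually_nhds.2 h1] with z' hz'
  exact (limsup_le_of_le (by isBoundedDefault) (hz'.mono fun _ h => h.le)).trans_lt hbc

theorem upperSemicontinuous_toReal {k : ℕ} {f : (Fin k → ℂ) → EReal}
    (hf : UpperSemicontinuous f) (hbot : ∀ z, f z ≠ ⊥) (htop : ∀ z, f z ≠ ⊤) :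
    UpperSemicontinuous fun z => (f z).toReal := by
  intro z c hc
  have h1 : f z < (c : EReal) := by
    rw [← EReal.coe_toReal (htop z) (hbot z)]
    exact_mod_cast hc
  filter_upwards [hf z c h1] with z' hz'
  rw [← EReal.coe_toReal (htop z') (hbot z')] at hz'
  exact_mod_cast hz'

/-- Each truncation of `uscReg f` is an admissible majorant of `f`, so its circle means dominate
`f`. They are upper semicontinuous in the centre, so they dominate `uscReg f` too. -/
theorem SubMean.isPlurisubharmonic_uscReg {k : ℕ} {f : (Fin k → ℂ) → EReal} (hf : SubMean f)
    {G : (Fin k → ℂ) → ℝ} (hG : Continuous G) (hle : ∀ z, f z ≤ (G z : EReal)) :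
    IsPlurisubharmonic (uscReg f) := by
  have hGe : UpperSemicontinuous fun z => (G z : EReal) :=
    (continuous_coe_real_ereal.comp hG).upperSemicontinuous
  have htop : ∀ z, uscReg f z ≠ ⊤ := fun z =>
    ((uscReg_le hGe hle z).trans_lt (EReal.coe_lt_top _)).ne
  refine ⟨upperSemicontinuous_uscReg f, htop, fun z w => le_iInf fun n => ?_⟩
  set h : (Fin k → ℂ) → EReal := fun x => max (uscReg f x) ((-(n : ℝ) : ℝ) : EReal) with hh
  have hbot' : ∀ x, h x ≠ ⊥ := fun x =>
    ((EReal.bot_lt_coe _).trans_le (le_max_right _ _)).ne'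
  have htop' : ∀ x, h x ≠ ⊤ := fun x =>
    (max_lt (lt_top_iff_ne_top.2 (htop x)) (EReal.coe_lt_top _)).ne
  have husc : UpperSemicontinuous h :=
    (upperSemicontinuous_uscReg f).sup continuous_const.upperSemicontinuous
  have hg := upperSemicontinuous_toReal husc hbot' htop'
  have hm : ∀ x, -(n : ℝ) ≤ (h x).toReal := fun x => by
    have : ((-(n : ℝ) : ℝ) : EReal) ≤ ((h x).toReal : EReal) := by
      rw [EReal.coe_toReal (htop' x) (hbot' x)]
      exact le_max_right _ _
    exact_mod_cast this
  have hA := upperSemicontinuous_circleAverage hg hm w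
  have hA' : UpperSemicontinuous fun z =>
      ((circleAverage (fun ζ : ℂ => (h (z + ζ • w)).toReal) 0 1 : ℝ) : EReal) :=
    continuous_coe_real_ereal.comp_upperSemicontinuous hA
      fun a b hab => EReal.coe_le_coe_iff.2 hab
  refine uscReg_le hA' (fun x => ?_) z
  refine hf _ _ hg hm (fun x => ?_) x w
  rw [EReal.coe_toReal (htop' x) (hbot' x)]
  exact (le_uscReg f x).trans (le_max_left _ _)

/-! ### Sub-mean value inequalities for logarithms and for convex functions. -/

/-- Jensen's inequality on the unit disc. -/
theorem log_norm_le_circleAverage {h : ℂ → ℂ} (hh : Differentiable ℂ h) (h0 : h 0 ≠ 0) :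
    Real.log ‖h 0‖ ≤ circleAverage (fun ζ => Real.log ‖h ζ‖) 0 1 := by
  have han : AnalyticOnNhd ℂ h (Metric.closedBall 0 |1|) := fun x _ => hh.analyticAt x
  rw [MeromorphicOn.circleAverage_log_norm one_ne_zero han.meromorphicOn,
    (hh.analyticAt 0).meromorphicTrailingCoeffAt_of_ne_zero h0]
  have : 0 ≤ ∑ᶠ u, (MeromorphicOn.divisor h (Metric.closedBall 0 |1|) u : ℝ)
      * Real.log (1 * ‖0 - u‖⁻¹) := by
    refine finsum_nonneg fun u => ?_
    by_cases hu : u ∈ Metric.closedBall (0 : ℂ) |1|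
    · refine mul_nonneg (by exact_mod_cast MeromorphicOn.AnalyticOnNhd.divisor_nonneg han u) ?_
      rcases eq_or_ne u 0 with rfl | hu0
      · simp
      · refine Real.log_nonneg ?_
        rw [one_mul, zero_sub, norm_neg]
        refine (one_le_inv₀ (norm_pos_iff.2 hu0)).2 ?_
        simpa using hu
    · simp [Function.locallyFinsuppWithin.apply_eq_zero_of_notMem _ hu]
  simp only [Real.log_one, mul_zero, add_zero]
  linarith

theorem eventually_ne_zero_on_circle {h : ℂ → ℂ} (hh : Differentiable ℂ h) (h0 : h 0 ≠ 0) :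
    ∀ᶠ ζ in codiscreteWithin (Metric.sphere (0 : ℂ) |1|), h ζ ≠ 0 := by
  have := AnalyticOnNhd.preimage_zero_mem_codiscrete (f := h)
    (fun x _ => hh.analyticAt x) h0
  exact codiscreteWithin_mono (Set.subset_univ _) this

/-- A combination of logarithms of moduli of holomorphic functions with nonnegative weights and of
a continuous function; it is `-∞` where one of the holomorphic functions vanishes. -/
def logCombination {k : ℕ} {J : Type*} [Fintype J] (p : (Fin k → ℂ) → ℝ) (c : J → ℝ)
    (h : J → (Fin k → ℂ) → ℂ) (z : Fin k → ℂ) : EReal :=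
  open Classical in
  if ∀ j, h j z ≠ 0 then ((p z + ∑ j, c j * Real.log ‖h j z‖ : ℝ) : EReal) else ⊥

theorem subMean_logCombination {k : ℕ} {J : Type*} [Fintype J] {p : (Fin k → ℂ) → ℝ}
    (hp : Continuous p)
    (hpm : ∀ z w, p z ≤ circleAverage (fun ζ : ℂ => p (z + ζ • w)) 0 1)
    {c : J → ℝ} (hc : ∀ j, 0 ≤ c j) {h : J → (Fin k → ℂ) → ℂ}
    (hh : ∀ j, Differentiable ℂ (h j)) : SubMean (logCombination p c h) := by
  classical
  intro g m hg hm hle z w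
  by_cases hz : ∀ j, h j z ≠ 0
  swap
  · rw [logCombination, if_neg hz]; exact bot_le
  rw [logCombination, if_pos hz, EReal.coe_le_coe_iff]
  have hline : ∀ j, Differentiable ℂ fun ζ : ℂ => h j (z + ζ • w) := fun j =>
    (hh j).comp (by fun_prop)
  have hj0 : ∀ j, h j (z + (0 : ℂ) • w) ≠ 0 := fun j => by simpa using hz j
  have hlogint : ∀ j, CircleIntegrable (fun ζ : ℂ => Real.log ‖h j (z + ζ • w)‖) 0 1 := fun j =>
    MeromorphicOn.circleIntegrable_log_norm
      fun x _ => ((hline j).analyticAt x).meromorphicAt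
  have hpint : CircleIntegrable (fun ζ : ℂ => p (z + ζ • w)) 0 1 :=
    (Continuous.continuousOn (by fun_prop)).circleIntegrable'
  set T : ℂ → ℝ := fun ζ => p (z + ζ • w) + ∑ j, c j * Real.log ‖h j (z + ζ • w)‖ with hT
  have hmulint : ∀ j, CircleIntegrable (fun ζ : ℂ => c j * Real.log ‖h j (z + ζ • w)‖) 0 1 :=
    fun j => (hlogint j).const_mul _
  have hsumint : CircleIntegrable (fun ζ : ℂ => ∑ j, c j * Real.log ‖h j (z + ζ • w)‖) 0 1 :=
    CircleIntegrable.fun_sum _ fun j _ => hmulint j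
  have hTint : CircleIntegrable T 0 1 := hpint.add hsumint
  have hgint := circleIntegrable_of_upperSemicontinuous hg hm z w
  -- At zeros of some `h j` the convention `log 0 = 0` may make `T` exceed `g`. Passing to the
  -- minimum gives a pointwise inequality and changes `T` only on a negligible set.
  have hev : T =ᶠ[codiscreteWithin (Metric.sphere (0 : ℂ) |1|)]
      fun ζ => min (T ζ) (g (z + ζ • w)) := by
    have := eventually_all.2 fun j => eventually_ne_zero_on_circle (hline j) (hj0 j)
    filter_upwards [this] with ζ hζ
    have h1 := hle (z + ζ • w)
    rw [logCombination, if_pos hζ, EReal.coe_le_coe_iff] at h1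
    exact (min_eq_left h1).symm
  calc p z + ∑ j, c j * Real.log ‖h j z‖
      ≤ circleAverage (fun ζ : ℂ => p (z + ζ • w)) 0 1
        + ∑ j, c j * circleAverage (fun ζ : ℂ => Real.log ‖h j (z + ζ • w)‖) 0 1 := by
        refine add_le_add (hpm z w) (Finset.sum_le_sum fun j _ => ?_)
        refine mul_le_mul_of_nonneg_left ?_ (hc j)
        have := log_norm_le_circleAverage (hline j) (hj0 j)
        simpa using this
    _ = circleAverage T 0 1 := by
        rw [hT, circleAverage_fun_add hpint hsumint,
          circleAverage_fun_sum fun j _ => hmulint j]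
        congr 1
        refine Finset.sum_congr rfl fun j _ => ?_
        simp_rw [← smul_eq_mul]
        rw [circleAverage_fun_smul]
    _ = circleAverage (fun ζ => min (T ζ) (g (z + ζ • w))) 0 1 :=
        circleAverage_congr_codiscreteWithin hev one_ne_zero
    _ ≤ circleAverage (fun ζ => g (z + ζ • w)) 0 1 :=
        circleAverage_mono (hTint.congr_codiscreteWithin hev) hgint fun ζ _ => min_le_right _ _

theorem circleAverage_neg {f : ℂ → ℝ} :
    circleAverage (fun ζ => f (-ζ)) 0 1 = circleAverage f 0 1 := by
  rw [circleAverage_eq_integral_add (f := f) π, circleAverage_def]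
  congr 2
  ext θ
  congr 1
  simp [circleMap, add_mul, Complex.exp_add]

/-- Continuous midpoint convex functions satisfy the sub-mean value inequality. -/
theorem le_circleAverage_of_midpoint {k : ℕ} {p : (Fin k → ℂ) → ℝ} (hp : Continuous p)
    (hmid : ∀ z v, 2 * p z ≤ p (z + v) + p (z - v)) (z w : Fin k → ℂ) :
    p z ≤ circleAverage (fun ζ : ℂ => p (z + ζ • w)) 0 1 := by
  have hi : CircleIntegrable (fun ζ : ℂ => p (z + ζ • w)) 0 1 :=
    (Continuous.continuousOn (by fun_prop)).circleIntegrable'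
  have hi' : CircleIntegrable (fun ζ : ℂ => p (z + (-ζ) • w)) 0 1 :=
    (Continuous.continuousOn (by fun_prop)).circleIntegrable'
  have h1 : circleAverage (fun _ : ℂ => 2 * p z) 0 1
      ≤ circleAverage (fun ζ : ℂ => p (z + ζ • w) + p (z + (-ζ) • w)) 0 1 :=
    circleAverage_mono (circleIntegrable_const _ _ _) (hi.add hi') fun ζ _ => by
      simpa [sub_eq_add_neg] using hmid z (ζ • w)
  rw [circleAverage_const, circleAverage_fun_add hi hi',
    circleAverage_neg (f := fun ζ : ℂ => p (z + ζ • w))] at h1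
  linarith

theorem continuous_rePart {k : ℕ} : Continuous (rePart (k := k)) := by
  unfold rePart; fun_prop

theorem continuous_imPart {k : ℕ} : Continuous (imPart (k := k)) := by
  unfold imPart; fun_prop

theorem continuous_comp_norm_imPart {k : ℕ} {β : ℝ → ℝ} (hβc : ContinuousOn β (Set.Ici 0))
    {b : ℝ} (hb : 0 ≤ b) : Continuous fun z : Fin k → ℂ => β (b * ‖imPart z‖) :=
  hβc.comp_continuous (continuous_const.mul continuous_imPart.norm)
    fun _ => mul_nonneg hb (norm_nonneg _)

theorem midpoint_comp_norm_imPart {k : ℕ} {β : ℝ → ℝ} (hβm : MonotoneOn β (Set.Ici 0))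
    (hβconv : ConvexOn ℝ (Set.Ici 0) β) {b : ℝ} (hb : 0 ≤ b) (z v : Fin k → ℂ) :
    2 * β (b * ‖imPart z‖) ≤ β (b * ‖imPart (z + v)‖) + β (b * ‖imPart (z - v)‖) := by
  have h0 : ∀ z : Fin k → ℂ, 0 ≤ b * ‖imPart z‖ := fun z => mul_nonneg hb (norm_nonneg _)
  have hsum : imPart z = (2⁻¹ : ℝ) • (imPart (z + v) + imPart (z - v)) := by
    ext j; simp [imPart]; ring
  have hn : ‖imPart z‖ ≤ 2⁻¹ * (‖imPart (z + v)‖ + ‖imPart (z - v)‖) := by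
    rw [hsum, norm_smul]
    simpa using norm_add_le (imPart (z + v)) (imPart (z - v))
  have h1 := hβconv.2 (h0 (z + v)) (h0 (z - v)) (by norm_num : (0 : ℝ) ≤ 2⁻¹)
    (by norm_num : (0 : ℝ) ≤ 2⁻¹) (by norm_num)
  have h2 : β (b * ‖imPart z‖)
      ≤ β ((2⁻¹ : ℝ) • (b * ‖imPart (z + v)‖) + (2⁻¹ : ℝ) • (b * ‖imPart (z - v)‖)) := by
    refine hβm (h0 z) ?_ ?_
    · have := h0 (z + v)
      have := h0 (z - v)
      simp only [smul_eq_mul, Set.mem_Ici]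
      positivity
    · simp only [smul_eq_mul]
      nlinarith [mul_le_mul_of_nonneg_left hn hb]
  simp only [smul_eq_mul] at h1 h2
  linarith

theorem continuous_rho {k : ℕ} {α β : ℝ → ℝ} (hαc : ContinuousOn α (Set.Ici 0))
    (hβc : ContinuousOn β (Set.Ici 0)) (U : Set (Fin k → ℝ)) {A B : ℝ} (hA : 0 ≤ A)
    (hB : 0 ≤ B) : Continuous (rho α β U A B) := by
  have h1 : Continuous fun z : Fin k → ℂ => α (‖rePart z‖ / A) :=
    hαc.comp_continuous (continuous_rePart.norm.div_const A)
      fun _ => div_nonneg (norm_nonneg _) hA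
  have h2 : Continuous fun z : Fin k → ℂ => β (B * Metric.infDist (rePart z) U) :=
    hβc.comp_continuous
      (continuous_const.mul ((Metric.continuous_infDist_pt U).comp continuous_rePart))
      fun _ => mul_nonneg hB Metric.infDist_nonneg
  exact (h1.neg.add (continuous_comp_norm_imPart hβc hB)).add h2

/-! ### Convex functions on the half-line. -/

section Convex

variable {β : ℝ → ℝ}

theorem map_mul_le_of_le_one (hβconv : ConvexOn ℝ (Set.Ici 0) β) (hβ0 : β 0 = 0) {a s : ℝ}
    (ha : 0 ≤ a) (ha1 : a ≤ 1) (hs : 0 ≤ s) : β (a * s) ≤ a * β s := by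
  have := hβconv.2 hs (Set.mem_Ici.2 le_rfl) ha (sub_nonneg.2 ha1) (by ring)
  simpa [hβ0] using this

theorem map_add_map_le (hβconv : ConvexOn ℝ (Set.Ici 0) β) (hβ0 : β 0 = 0) {s t : ℝ}
    (hs : 0 ≤ s) (ht : 0 ≤ t) : β s + β t ≤ β (s + t) := by
  rcases (add_nonneg hs ht).eq_or_lt with h | h
  · have h1 : s = 0 := by linarith
    have h2 : t = 0 := by linarith
    simp [h1, h2, hβ0]
  · have h1 := map_mul_le_of_le_one hβconv hβ0 (div_nonneg hs h.le)
      (div_le_one_of_le₀ (by linarith) h.le) h.le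
    have h2 := map_mul_le_of_le_one hβconv hβ0 (div_nonneg ht h.le)
      (div_le_one_of_le₀ (by linarith) h.le) h.le
    rw [div_mul_cancel₀ _ h.ne'] at h1 h2
    have : s / (s + t) * β (s + t) + t / (s + t) * β (s + t) = β (s + t) := by
      field_simp
    linarith

theorem natCast_mul_map_le (hβconv : ConvexOn ℝ (Set.Ici 0) β) (hβ0 : β 0 = 0) {s : ℝ}
    (hs : 0 ≤ s) (n : ℕ) : n * β s ≤ β (n * s) := by
  induction n with
  | zero => simp [hβ0]
  | succ n ih =>
    have := map_add_map_le hβconv hβ0 (mul_nonneg n.cast_nonneg hs) hs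
    push_cast
    rw [add_mul, add_mul, one_mul, one_mul]
    linarith

theorem map_add_le_half (hβconv : ConvexOn ℝ (Set.Ici 0) β) {s t : ℝ}
    (hs : 0 ≤ s) (ht : 0 ≤ t) : β (s + t) ≤ 1 / 2 * β (2 * s) + 1 / 2 * β (2 * t) := by
  have := hβconv.2 (Set.mem_Ici.2 (mul_nonneg zero_le_two hs))
    (Set.mem_Ici.2 (mul_nonneg zero_le_two ht)) (by norm_num : (0 : ℝ) ≤ 1 / 2)
    (by norm_num : (0 : ℝ) ≤ 1 / 2) (by norm_num)
  simp only [smul_eq_mul] at this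
  rwa [show 1 / 2 * (2 * s) + 1 / 2 * (2 * t) = s + t by ring] at this

theorem exists_subgradient (hβm : MonotoneOn β (Set.Ici 0))
    (hβconv : ConvexOn ℝ (Set.Ici 0) β) {s : ℝ} (hs : 0 ≤ s) :
    ∃ t, 0 ≤ t ∧ ∀ u, 0 ≤ u → β s + t * (u - s) ≤ β u := by
  rcases hs.eq_or_lt with rfl | hs'
  -- At the endpoint monotonicity alone gives the slope 0; at interior points the right derivative
  -- serves.
  · exact ⟨0, le_rfl, fun u hu => by simpa using hβm (Set.mem_Ici.2 le_rfl) hu hu⟩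
  have hint : s ∈ interior (Set.Ici (0 : ℝ)) := by simpa using hs'
  have hsub : ∀ u, 0 ≤ u → β s + derivWithin β (Set.Ioi s) s * (u - s) ≤ β u := by
    intro u hu
    rcases lt_trichotomy u s with h | rfl | h
    · have h1 := hβconv.slope_le_leftDeriv_of_mem_interior (Set.mem_Ici.2 hu) hint h
      have h2 := hβconv.leftDeriv_le_rightDeriv_of_mem_interior hint
      have h3 := h1.trans h2
      rw [slope_def_field, div_le_iff₀ (by linarith)] at h3
      linarith
    · simp
    · have h1 := hβconv.rightDeriv_le_slope_of_mem_interior hint (Set.mem_Ici.2 hu) h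
      rw [slope_def_field, le_div_iff₀ (by linarith)] at h1
      linarith
  refine ⟨derivWithin β (Set.Ioi s) s, ?_, hsub⟩
  have h1 := hsub 0 le_rfl
  have h2 := hβm (Set.mem_Ici.2 le_rfl) hs hs
  by_contra! hneg
  nlinarith

end Convex

/-! ### The entire function `sin w / w`. -/

section Sinc

/-- The entire function `sin w / w`. -/
def csinc : ℂ → ℂ := dslope Complex.sin 0

theorem differentiable_csinc : Differentiable ℂ csinc := by
  have := (Complex.differentiableOn_dslope (f := Complex.sin) (c := 0) (s := Set.univ)
    Filter.univ_mem).2 Complex.differentiable_sin.differentiableOn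
  exact differentiableOn_univ.1 this

theorem csinc_zero : csinc 0 = 1 := by
  simp [csinc, dslope_same]

theorem mul_csinc (w : ℂ) : w * csinc w = Complex.sin w := by
  have := sub_smul_dslope Complex.sin 0 w
  simpa [csinc] using this

theorem norm_sin_le (w : ℂ) : ‖Complex.sin w‖ ≤ exp |w.im| := by
  have h1 : ‖Complex.exp (-w * Complex.I)‖ ≤ exp |w.im| := by
    rw [Complex.norm_exp]
    exact exp_le_exp.2 (by simpa using le_abs_self w.im)
  have h2 : ‖Complex.exp (w * Complex.I)‖ ≤ exp |w.im| := by
    rw [Complex.norm_exp]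
    exact exp_le_exp.2 (by simpa using neg_le_abs w.im)
  rw [Complex.sin, norm_div, norm_mul, Complex.norm_I, mul_one, Complex.norm_ofNat]
  have := norm_sub_le (Complex.exp (-w * Complex.I)) (Complex.exp (w * Complex.I))
  linarith

theorem norm_cos_le (w : ℂ) : ‖Complex.cos w‖ ≤ exp |w.im| := by
  have h1 : ‖Complex.exp (-w * Complex.I)‖ ≤ exp |w.im| := by
    rw [Complex.norm_exp]
    exact exp_le_exp.2 (by simpa using le_abs_self w.im)
  have h2 : ‖Complex.exp (w * Complex.I)‖ ≤ exp |w.im| := by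
    rw [Complex.norm_exp]
    exact exp_le_exp.2 (by simpa using neg_le_abs w.im)
  rw [Complex.cos, norm_div, Complex.norm_ofNat]
  have := norm_add_le (Complex.exp (w * Complex.I)) (Complex.exp (-w * Complex.I))
  linarith

/-- Mean value inequality for `sin` between 0 and `w`, in the strip where `|cos| ≤ exp |Im w|`. -/
theorem norm_csinc_le (w : ℂ) : ‖csinc w‖ ≤ exp |w.im| := by
  rcases eq_or_ne w 0 with rfl | hw
  · simp [csinc_zero]
  have hconv : Convex ℝ {v : ℂ | |v.im| ≤ |w.im|} := by
    have : {v : ℂ | |v.im| ≤ |w.im|} = Complex.imLm ⁻¹' Set.Icc (-|w.im|) |w.im| := by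
      ext v; simp [abs_le]
    rw [this]
    exact (convex_Icc _ _).linear_preimage _
  have := hconv.norm_image_sub_le_of_norm_deriv_le (f := Complex.sin) (C := exp |w.im|)
    (x := 0) (y := w) (fun v _ => Complex.differentiable_sin v)
    (fun v hv => by
      rw [Complex.deriv_sin]
      exact (norm_cos_le v).trans (exp_le_exp.2 hv)) (by simp) (by simp)
  rw [Complex.sin_zero, sub_zero, sub_zero, ← mul_csinc, norm_mul, mul_comm] at this
  exact le_of_mul_le_mul_right this (norm_pos_iff.2 hw)

/-- On the imaginary axis this is `|sinh y| ≥ |y|`; it keeps the localizing factors harmless over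
`ξ`. -/
theorem one_le_norm_csinc {w : ℂ} (hw : w.re = 0) : 1 ≤ ‖csinc w‖ := by
  rcases eq_or_ne w 0 with rfl | hw0
  · simp [csinc_zero]
  have hwI : w = w.im * Complex.I := by
    apply Complex.ext <;> simp [hw]
  have h1 : ‖w‖ = |w.im| := by rw [hwI]; simp
  have h2 : ‖Complex.sin w‖ = |sinh w.im| := by
    conv_lhs => rw [hwI]
    rw [Complex.sin_mul_I, norm_mul, Complex.norm_I, mul_one, ← Complex.ofReal_sinh,
      Complex.norm_real, Real.norm_eq_abs]
  have h3 : |w.im| ≤ |sinh w.im| := by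
    rw [Real.abs_sinh]
    exact Real.self_le_sinh_iff.2 (abs_nonneg _)
  rw [← h1, ← h2, ← mul_csinc, norm_mul] at h3
  exact (le_mul_iff_one_le_right (norm_pos_iff.2 hw0)).1 h3

theorem log_norm_csinc_le (w : ℂ) : log ‖csinc w‖ ≤ |w.im| := by
  rcases eq_or_ne (csinc w) 0 with h | h
  · simp [h]
  · rw [Real.log_le_iff_le_exp (norm_pos_iff.2 h)]
    exact norm_csinc_le w

theorem log_norm_csinc_le_sub_one {w : ℂ} (h : csinc w ≠ 0) (hw : exp 1 ≤ |w.re|) :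
    log ‖csinc w‖ ≤ |w.im| - 1 := by
  rw [Real.log_le_iff_le_exp (norm_pos_iff.2 h), Real.exp_sub, le_div_iff₀ (exp_pos 1)]
  calc ‖csinc w‖ * exp 1 ≤ ‖csinc w‖ * ‖w‖ :=
        mul_le_mul_of_nonneg_left (hw.trans (Complex.abs_re_le_norm w)) (norm_nonneg _)
    _ = ‖Complex.sin w‖ := by rw [← mul_csinc, norm_mul, mul_comm]
    _ ≤ exp |w.im| := norm_sin_le w

end Sinc

/-! ### Estimates for the two families of factors. -/

/-- The bound for `β (s) + t s ∑ⱼ log |sinc (2e (z_j - ξ_j) / r)|` with `s = B r` and `t` a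
subgradient of `β` at `s`. -/
theorem localized_le {k : ℕ} {β : ℝ → ℝ} (hβm : MonotoneOn β (Set.Ici 0)) (hβ0 : β 0 = 0)
    {B r t : ℝ} (hB : 0 < B) (hr : 0 ≤ r) (ht : 0 ≤ t)
    (hsub : ∀ u, 0 ≤ u → β (B * r) + t * (u - B * r) ≤ β u) (ξ : Fin k → ℝ) {z : Fin k → ℂ}
    (hz : ∀ j, csinc ((2 * exp 1 / r : ℝ) * (z j - ξ j)) ≠ 0) :
    β (B * r) + ∑ j, t * (B * r) * log ‖csinc ((2 * exp 1 / r : ℝ) * (z j - ξ j))‖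
        ≤ β (2 * exp 1 * k * B * ‖imPart z‖) + β (2 * B * r) ∧
      (r / 2 ≤ ‖rePart z - ξ‖ →
        β (B * r) + ∑ j, t * (B * r) * log ‖csinc ((2 * exp 1 / r : ℝ) * (z j - ξ j))‖
          ≤ β (2 * exp 1 * k * B * ‖imPart z‖)) := by
  have hnn : ∀ s, 0 ≤ s → 0 ≤ β s := fun s hs => hβ0 ▸ hβm (Set.mem_Ici.2 le_rfl) hs hs
  have he := exp_pos 1
  have hy0 : 0 ≤ 2 * exp 1 * k * B * ‖imPart z‖ := by positivity
  rcases hr.eq_or_lt with rfl | hr'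
  -- For `r = 0` the weight `t * (B * r)` vanishes and so does `β (B * r)`.
  · simp [hβ0, hnn _ hy0]
  have him : ∀ j, |((2 * exp 1 / r : ℝ) * (z j - ξ j) : ℂ).im|
      ≤ 2 * exp 1 / r * ‖imPart z‖ := by
    intro j
    rw [Complex.im_ofReal_mul, abs_mul, abs_of_pos (by positivity)]
    refine mul_le_mul_of_nonneg_left ?_ (by positivity)
    simpa [imPart] using norm_le_pi_norm (imPart z) j
  have hre : ∀ j, |((2 * exp 1 / r : ℝ) * (z j - ξ j) : ℂ).re|
      = 2 * exp 1 / r * |(rePart z - ξ) j| := by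
    intro j
    rw [Complex.re_ofReal_mul, abs_mul, abs_of_pos (by positivity)]
    simp [rePart]
  have hN : 0 ≤ t * (B * r) := by positivity
  have hterm : ∀ j, t * (B * r) * log ‖csinc ((2 * exp 1 / r : ℝ) * (z j - ξ j))‖
      ≤ t * (2 * exp 1 * B * ‖imPart z‖) := by
    intro j
    calc _ ≤ t * (B * r) * (2 * exp 1 / r * ‖imPart z‖) :=
          mul_le_mul_of_nonneg_left ((log_norm_csinc_le _).trans (him j)) hN
      _ = _ := by field_simp
  have hsum : ∑ j, t * (B * r) * log ‖csinc ((2 * exp 1 / r : ℝ) * (z j - ξ j))‖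
      ≤ t * (2 * exp 1 * k * B * ‖imPart z‖) := by
    calc _ ≤ ∑ _j : Fin k, t * (2 * exp 1 * B * ‖imPart z‖) :=
          Finset.sum_le_sum fun j _ => hterm j
      _ = _ := by simp; ring
  have h1 := hsub _ hy0
  refine ⟨?_, fun hfar => ?_⟩
  -- With `s = B r`, the subgradient inequality at `2s` gives `t s ≤ β (2s)`, which pays for the
  -- missing `-t s`.
  · have h2 := hsub (2 * B * r) (by positivity)
    have h3 := hnn (B * r) (by positivity)
    nlinarith
  · obtain ⟨i, hi⟩ : ∃ i, r / 2 ≤ |(rePart z - ξ) i| := by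
      by_contra! hcon
      exact absurd ((pi_norm_lt_iff (by positivity)).2 hcon) (not_lt.2 hfar)
    have hterm' : ∀ j, t * (B * r) * log ‖csinc ((2 * exp 1 / r : ℝ) * (z j - ξ j))‖
        ≤ t * (2 * exp 1 * B * ‖imPart z‖) - if j = i then t * (B * r) else 0 := by
      intro j
      split_ifs with hj
      · subst hj
        have hbig : exp 1 ≤ |((2 * exp 1 / r : ℝ) * (z j - ξ j) : ℂ).re| := by
          rw [hre]
          calc exp 1 = 2 * exp 1 / r * (r / 2) := by field_simp
            _ ≤ _ := mul_le_mul_of_nonneg_left hi (by positivity)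
        calc _ ≤ t * (B * r) * (2 * exp 1 / r * ‖imPart z‖ - 1) :=
              mul_le_mul_of_nonneg_left ((log_norm_csinc_le_sub_one (hz j) hbig).trans
                (sub_le_sub_right (him j) 1)) hN
          _ = _ := by field_simp
      · simpa using hterm j
    have hsum' : ∑ j, t * (B * r) * log ‖csinc ((2 * exp 1 / r : ℝ) * (z j - ξ j))‖
        ≤ t * (2 * exp 1 * k * B * ‖imPart z‖) - t * (B * r) := by
      calc _ ≤ ∑ j : Fin k, (t * (2 * exp 1 * B * ‖imPart z‖)
              - if j = i then t * (B * r) else 0) := Finset.sum_le_sum fun j _ => hterm' j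
        _ = _ := by simp [Finset.sum_sub_distrib]; ring
    nlinarith

/-- The bound for products of translates of `φ`. -/
theorem sum_log_norm_translate_le {k : ℕ} {α β : ℝ → ℝ} (hαm : MonotoneOn α (Set.Ici 0))
    (hα0 : α 0 = 0) (hβm : MonotoneOn β (Set.Ici 0)) (hβconv : ConvexOn ℝ (Set.Ici 0) β)
    (hβ0 : β 0 = 0) {A A₀ B₀ : ℝ} (hA : 0 < A) (hA₀ : 0 < A₀) (hB₀ : 0 < B₀) {φ : ℂ → ℂ}
    (hφb : ∀ z : ℂ, ‖φ z‖ ≤ Real.exp (β (B₀ * |z.im|) - α (|z.re| / A₀)))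
    (ξ η : Fin k → ℝ) {z : Fin k → ℂ}
    (hz : ∀ j, φ ((A₀ / A : ℝ) * (z j - ξ j) - η j * Complex.I) ≠ 0) :
    ∑ j, log ‖φ ((A₀ / A : ℝ) * (z j - ξ j) - η j * Complex.I)‖
      ≤ k / 4 * β (4 * (A₀ * B₀ / A) * ‖imPart z‖) + ∑ j, 1 / 2 * β (2 * (B₀ * |η j|))
        - α (‖rePart z - ξ‖ / A) := by
  have hαnn : ∀ s, 0 ≤ s → 0 ≤ α s := fun s hs => hα0 ▸ hαm (Set.mem_Ici.2 le_rfl) hs hs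
  have hterm : ∀ j, log ‖φ ((A₀ / A : ℝ) * (z j - ξ j) - η j * Complex.I)‖
      ≤ 1 / 4 * β (4 * (A₀ * B₀ / A) * ‖imPart z‖) + 1 / 2 * β (2 * (B₀ * |η j|))
        - α (|(rePart z - ξ) j| / A) := by
    intro j
    have h1 := hφb ((A₀ / A : ℝ) * (z j - ξ j) - η j * Complex.I)
    have him : ((A₀ / A : ℝ) * (z j - ξ j) - η j * Complex.I : ℂ).im
        = A₀ / A * (imPart z) j - η j := by
      rw [Complex.sub_im, Complex.im_ofReal_mul]; simp [imPart]
    have hre : ((A₀ / A : ℝ) * (z j - ξ j) - η j * Complex.I : ℂ).re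
        = A₀ / A * (rePart z - ξ) j := by
      rw [Complex.sub_re, Complex.re_ofReal_mul]; simp [rePart]
    have hre' : |A₀ / A * (rePart z - ξ) j| / A₀ = |(rePart z - ξ) j| / A := by
      rw [abs_mul, abs_of_pos (by positivity)]; field_simp
    rw [him, hre, hre', ← Real.log_le_iff_le_exp (norm_pos_iff.2 (hz j))] at h1
    have hy : |imPart z j| ≤ ‖imPart z‖ := norm_le_pi_norm (imPart z) j
    have h2 : β (B₀ * |A₀ / A * imPart z j - η j|)
        ≤ β (A₀ * B₀ / A * ‖imPart z‖ + B₀ * |η j|) := by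
      refine hβm (Set.mem_Ici.2 (by positivity)) (Set.mem_Ici.2 (by positivity)) ?_
      calc B₀ * |A₀ / A * imPart z j - η j|
          ≤ B₀ * (A₀ / A * |imPart z j| + |η j|) := by
            refine mul_le_mul_of_nonneg_left ?_ hB₀.le
            calc _ ≤ |A₀ / A * imPart z j| + |η j| := abs_sub _ _
              _ = _ := by rw [abs_mul, abs_of_pos (by positivity : 0 < A₀ / A)]
        _ ≤ B₀ * (A₀ / A * ‖imPart z‖ + |η j|) := by gcongr
        _ = _ := by ring
    have h3 := map_add_le_half hβconv (s := A₀ * B₀ / A * ‖imPart z‖) (t := B₀ * |η j|)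
      (by positivity) (by positivity)
    -- Trading `β (2a)` for `β (4a) / 2` leaves the same expression in `|y|` as the one needed to
    -- absorb the `η` penalty in `le_localBlock`.
    have h4 := map_mul_le_of_le_one hβconv hβ0 (a := 1 / 2)
      (s := 4 * (A₀ * B₀ / A) * ‖imPart z‖) (by norm_num) (by norm_num) (by positivity)
    rw [show 1 / 2 * (4 * (A₀ * B₀ / A) * ‖imPart z‖) = 2 * (A₀ * B₀ / A * ‖imPart z‖) by ring]
      at h4
    linarith
  have hα : α (‖rePart z - ξ‖ / A) ≤ ∑ j, α (|(rePart z - ξ) j| / A) := by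
    have hnn : ∀ j, 0 ≤ α (|(rePart z - ξ) j| / A) := fun j => hαnn _ (by positivity)
    rcases (norm_nonneg (rePart z - ξ)).eq_or_lt with h | h
    · rw [← h, zero_div, hα0]
      exact Finset.sum_nonneg fun j _ => hnn j
    · obtain ⟨i, hi⟩ : ∃ i, ‖rePart z - ξ‖ ≤ |(rePart z - ξ) i| := by
        by_contra! hcon
        exact lt_irrefl _ ((pi_norm_lt_iff h).2 hcon)
      exact (hαm (Set.mem_Ici.2 (by positivity)) (Set.mem_Ici.2 (by positivity))
        (by gcongr)).trans (Finset.single_le_sum (fun j _ => hnn j) (Finset.mem_univ i))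
  calc _ ≤ ∑ j, (1 / 4 * β (4 * (A₀ * B₀ / A) * ‖imPart z‖) + 1 / 2 * β (2 * (B₀ * |η j|))
        - α (|(rePart z - ξ) j| / A)) := Finset.sum_le_sum fun j _ => hterm j
    _ = k / 4 * β (4 * (A₀ * B₀ / A) * ‖imPart z‖) + ∑ j, 1 / 2 * β (2 * (B₀ * |η j|))
        - ∑ j, α (|(rePart z - ξ) j| / A) := by
        rw [Finset.sum_sub_distrib, Finset.sum_add_distrib]
        simp; ring
    _ ≤ _ := by linarith

/-- An entire function that does not vanish identically has a nonzero value on the imaginary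
axis. -/
theorem exists_ne_zero_on_imaginary_axis {φ : ℂ → ℂ} (hφ : Differentiable ℂ φ) (hφ0 : φ ≠ 0) :
    ∃ s : ℝ, φ (s * Complex.I) ≠ 0 := by
  by_contra! hcon
  refine hφ0 ?_
  have han : AnalyticOnNhd ℂ φ Set.univ := fun x _ => hφ.analyticAt x
  refine han.eq_of_frequently_eq (z₀ := 0) (fun x _ => analyticAt_const) ?_
  have ht : Tendsto (fun s : ℝ => (s : ℂ) * Complex.I) (𝓝[≠] 0) (𝓝[≠] 0) := by
    refine tendsto_nhdsWithin_iff.2 ⟨?_, ?_⟩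
    · have : Continuous fun s : ℝ => (s : ℂ) * Complex.I := by fun_prop
      simpa using (this.tendsto 0).mono_left nhdsWithin_le_nhds
    · filter_upwards [self_mem_nhdsWithin] with s hs
      simpa using hs
  exact ht.frequently (Eventually.of_forall fun s => hcon s).frequently

theorem logCombination_le {k : ℕ} {J : Type*} [Fintype J] {p : (Fin k → ℂ) → ℝ} {c : J → ℝ}
    {h : J → (Fin k → ℂ) → ℂ} {z : Fin k → ℂ} {b : ℝ}
    (hb : (∀ j, h j z ≠ 0) → p z + ∑ j, c j * Real.log ‖h j z‖ ≤ b) :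
    logCombination p c h z ≤ (b : EReal) := by
  unfold logCombination
  split_ifs with hz
  · exact EReal.coe_le_coe_iff.2 (hb hz)
  · exact bot_le

/-! ### The building blocks and their bounds. -/

/-- The building block concentrated at `ξ + i y`, where `(A₀ / A) y_j = η_j` up to a constant; `t`
is the weight of the localizing factor. -/
def localBlock {k : ℕ} (α β : ℝ → ℝ) (U : Set (Fin k → ℝ)) (A B A₀ B₀ : ℝ) (φ : ℂ → ℂ) (t C : ℝ)
    (ξ η : Fin k → ℝ) : (Fin k → ℂ) → EReal :=
  logCombination
    (fun z => C - α (‖ξ‖ / A) + β (B * Metric.infDist ξ U) - ∑ j, 1 / 2 * β (2 * (B₀ * |η j|))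
      + β (B * ‖imPart z‖) + k / 4 * β (4 * (A₀ * B₀ / A) * ‖imPart z‖))
    (Sum.elim (fun _ : Fin k => t * (B * Metric.infDist ξ U)) fun _ : Fin k => 1)
    (Sum.elim (fun j z => csinc ((2 * exp 1 / Metric.infDist ξ U : ℝ) * (z j - ξ j)))
      fun j z => φ ((A₀ / A : ℝ) * (z j - ξ j) - η j * Complex.I))

theorem subMean_localBlock {k : ℕ} {α β : ℝ → ℝ} (U : Set (Fin k → ℝ)) {A B A₀ B₀ : ℝ}
    (hA : 0 < A) (hB : 0 < B) (hA₀ : 0 < A₀) (hB₀ : 0 < B₀)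
    (hβc : ContinuousOn β (Set.Ici 0)) (hβm : MonotoneOn β (Set.Ici 0))
    (hβconv : ConvexOn ℝ (Set.Ici 0) β) {φ : ℂ → ℂ} (hφ : Differentiable ℂ φ) {t : ℝ} (ht : 0 ≤ t)
    (C : ℝ) (ξ η : Fin k → ℝ) : SubMean (localBlock α β U A B A₀ B₀ φ t C ξ η) := by
  have hb : 0 ≤ 4 * (A₀ * B₀ / A) := by positivity
  have hcont : Continuous fun z : Fin k → ℂ => C - α (‖ξ‖ / A) + β (B * Metric.infDist ξ U)
      - ∑ j, 1 / 2 * β (2 * (B₀ * |η j|))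
      + β (B * ‖imPart z‖) + k / 4 * β (4 * (A₀ * B₀ / A) * ‖imPart z‖) :=
    (continuous_const.add (continuous_comp_norm_imPart hβc hB.le)).add
      (continuous_const.mul (continuous_comp_norm_imPart hβc hb))
  refine subMean_logCombination hcont (le_circleAverage_of_midpoint hcont fun z v => ?_) ?_ ?_
  · have h1 := midpoint_comp_norm_imPart hβm hβconv hB.le z v
    have h2 := mul_le_mul_of_nonneg_left (midpoint_comp_norm_imPart hβm hβconv hb z v)
      (by positivity : (0 : ℝ) ≤ k / 4)
    linarith
  · rintro (j | j)
    · exact mul_nonneg ht (mul_nonneg hB.le Metric.infDist_nonneg)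
    · exact zero_le_one
  · rintro (j | j)
    · exact differentiable_csinc.comp (by fun_prop)
    · exact hφ.comp (by fun_prop)

/-- Both upper bounds for the building blocks. -/
theorem localBlock_le {k : ℕ} {α β : ℝ → ℝ} {U : Set (Fin k → ℝ)} (hUne : U.Nonempty)
    {A B A₀ B₀ A' B' : ℝ} (hA : 0 < A) (hB : 0 < B) (hA₀ : 0 < A₀) (hB₀ : 0 < B₀)
    (hA' : 0 < A') (hαm : MonotoneOn α (Set.Ici 0)) (hα0 : α 0 = 0)
    (hαA : ∀ a b, 0 ≤ a → 0 ≤ b → α ((a + b) / A') ≤ α (a / A) + α (b / A))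
    (hβm : MonotoneOn β (Set.Ici 0)) (hβconv : ConvexOn ℝ (Set.Ici 0) β) (hβ0 : β 0 = 0)
    {φ : ℂ → ℂ} (hφb : ∀ z : ℂ, ‖φ z‖ ≤ Real.exp (β (B₀ * |z.im|) - α (|z.re| / A₀)))
    (hB' : B' = (2 * Real.exp 1 * k + 1) * B + 4 * k * A₀ * B₀ / A)
    {t C : ℝ} (ht : 0 ≤ t) (ξ η : Fin k → ℝ)
    (hsub : ∀ u, 0 ≤ u →
      β (B * Metric.infDist ξ U) + t * (u - B * Metric.infDist ξ U) ≤ β u) (z : Fin k → ℂ) :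
    localBlock α β U A B A₀ B₀ φ t C ξ η z ≤ ((rho α β U A' B' z + C : ℝ) : EReal) ∧
    ∀ M, Metric.infDist ξ U ≤ M → localBlock α β U A B A₀ B₀ φ t C ξ η z
      ≤ ((rho α β Set.univ A' B' z + β (2 * B * M) + C : ℝ) : EReal) := by
  set r := Metric.infDist ξ U with hr
  have hr0 : 0 ≤ r := Metric.infDist_nonneg
  have hnn : ∀ s, 0 ≤ s → 0 ≤ β s := fun s hs => hβ0 ▸ hβm (Set.mem_Ici.2 le_rfl) hs hs
  have he := exp_pos 1
  have hk : (0 : ℝ) ≤ k := k.cast_nonneg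
  have hB'0 : 0 ≤ B' := by rw [hB']; positivity
  -- The coefficient `k / 2` collects `k / 4` from the block and `k / 4` from the translates of `φ`.
  -- Superadditivity of `β` then produces exactly the three terms of `B'`.
  have hβsum : β (B * ‖imPart z‖) + k / 2 * β (4 * (A₀ * B₀ / A) * ‖imPart z‖)
      + β (2 * exp 1 * k * B * ‖imPart z‖) ≤ β (B' * ‖imPart z‖) := by
    have h1 := natCast_mul_map_le hβconv hβ0
      (s := 4 * (A₀ * B₀ / A) * ‖imPart z‖) (by positivity) k
    have h2 := map_add_map_le hβconv hβ0 (s := B * ‖imPart z‖)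
      (t := k * (4 * (A₀ * B₀ / A) * ‖imPart z‖)) (by positivity) (by positivity)
    have h3 := map_add_map_le hβconv hβ0
      (s := B * ‖imPart z‖ + k * (4 * (A₀ * B₀ / A) * ‖imPart z‖))
      (t := 2 * exp 1 * k * B * ‖imPart z‖) (by positivity) (by positivity)
    have h4 : B' * ‖imPart z‖ = B * ‖imPart z‖ + k * (4 * (A₀ * B₀ / A) * ‖imPart z‖)
        + 2 * exp 1 * k * B * ‖imPart z‖ := by rw [hB']; ring
    have h5 : 0 ≤ k * β (4 * (A₀ * B₀ / A) * ‖imPart z‖) :=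
      mul_nonneg hk (hnn _ (by positivity))
    rw [h4]
    linarith
  have hαsum : α (‖rePart z‖ / A') ≤ α (‖ξ‖ / A) + α (‖rePart z - ξ‖ / A) := by
    refine le_trans (hαm (Set.mem_Ici.2 (by positivity)) (Set.mem_Ici.2 (by positivity)) ?_)
      (hαA _ _ (norm_nonneg ξ) (norm_nonneg (rePart z - ξ)))
    gcongr
    simpa using norm_add_le ξ (rePart z - ξ)
  have hbound : ∀ b, ((∀ j, csinc ((2 * exp 1 / r : ℝ) * (z j - ξ j)) ≠ 0) →
      β (B * r) + ∑ j, t * (B * r) * log ‖csinc ((2 * exp 1 / r : ℝ) * (z j - ξ j))‖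
        ≤ β (2 * exp 1 * k * B * ‖imPart z‖) + b) →
      localBlock α β U A B A₀ B₀ φ t C ξ η z
        ≤ ((-α (‖rePart z‖ / A') + β (B' * ‖imPart z‖) + b + C : ℝ) : EReal) := by
    intro b hb
    refine logCombination_le fun hz => ?_
    have h1 := hb fun j => hz (Sum.inl j)
    have h2 := sum_log_norm_translate_le hαm hα0 hβm hβconv hβ0 hA hA₀ hB₀ hφb ξ η (z := z)
      fun j => hz (Sum.inr j)
    simp only [Fintype.sum_sum_type, Sum.elim_inl, Sum.elim_inr, one_mul, ← hr]
    linarith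
  have hloc := fun hz => localized_le hβm hβ0 hB hr0 ht hsub ξ (z := z) hz
  refine ⟨hbound _ fun hz => ?_, fun M hM => ?_⟩
  · have hd0 : 0 ≤ Metric.infDist (rePart z) U := Metric.infDist_nonneg
    rcases le_or_gt (r / 2) ‖rePart z - ξ‖ with h | h
    · have := (hloc hz).2 h
      have := hnn (B' * Metric.infDist (rePart z) U) (by positivity)
      linarith
    · refine (hloc hz).1.trans (add_le_add_right (hβm (Set.mem_Ici.2 (by positivity))
        (Set.mem_Ici.2 (by positivity)) ?_) _)
      have hlip : r ≤ Metric.infDist (rePart z) U + ‖rePart z - ξ‖ := by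
        rw [← dist_eq_norm, dist_comm]
        exact Metric.infDist_le_infDist_add_dist
      have hr4 : 2 * B * r ≤ 4 * B * Metric.infDist (rePart z) U := by nlinarith
      -- The comparison `4B ≤ B'` comes from `2ek ≥ 4`, hence needs `k ≥ 1`. For `k = 0` the
      -- nonempty `U` is the whole space and `r = 0`.
      rcases Nat.eq_zero_or_pos k with rfl | hkpos
      · have hsubs : ξ ∈ U := by
          obtain ⟨u, hu⟩ := hUne
          rwa [Subsingleton.elim ξ u]
        have : r = 0 := Metric.infDist_zero_of_mem hsubs
        rw [this, mul_zero]
        positivity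
      · refine hr4.trans (mul_le_mul_of_nonneg_right ?_ hd0)
        have h1 : (1 : ℝ) ≤ k := by exact_mod_cast hkpos
        have h2 : (2 : ℝ) ≤ exp 1 := by have := add_one_le_exp (1 : ℝ); linarith
        have h3 : 4 ≤ 2 * exp 1 * k := by nlinarith
        have h4 : 0 ≤ 4 * k * A₀ * B₀ / A := by positivity
        rw [hB']
        nlinarith
  · have h := hbound (β (2 * B * M)) fun hz => (hloc hz).1.trans
      (add_le_add_right (hβm (Set.mem_Ici.2 (by positivity))
        (Set.mem_Ici.2 (by have := hr0.trans hM; positivity)) (by gcongr)) _)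
    simpa [rho, Metric.infDist_zero_of_mem (Set.mem_univ _), hβ0] using h

/-- The lower bound for the building block concentrated at a given point. -/
theorem le_localBlock {k : ℕ} {α β : ℝ → ℝ} (U : Set (Fin k → ℝ))
    {A B A₀ B₀ : ℝ} (hA : 0 < A) (hB : 0 < B) (hA₀ : 0 < A₀) (hB₀ : 0 < B₀)
    (hβm : MonotoneOn β (Set.Ici 0)) (hβconv : ConvexOn ℝ (Set.Ici 0) β)
    {φ : ℂ → ℂ} {s : ℝ} (hs : φ (s * Complex.I) ≠ 0) {t : ℝ} (C : ℝ) (ht : 0 ≤ t)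
    (z : Fin k → ℂ) :
    ((rho α β U A B z
        - (k / 4 * β (4 * (B₀ * |s|)) - k * log ‖φ (s * Complex.I)‖ - C) : ℝ) : EReal)
      ≤ localBlock α β U A B A₀ B₀ φ t C (rePart z) (fun j => A₀ / A * imPart z j - s) z := by
  have hzre : ∀ j, z j - (rePart z j : ℂ) = imPart z j * Complex.I := by
    intro j
    apply Complex.ext <;> simp [rePart, imPart]
  have hφarg : ∀ j, (A₀ / A : ℝ) * (z j - (rePart z j : ℂ))
      - ((A₀ / A * imPart z j - s : ℝ) : ℂ) * Complex.I = s * Complex.I := by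
    intro j
    rw [hzre]
    push_cast
    ring
  set r := Metric.infDist (rePart z) U with hr
  have hr0 : 0 ≤ r := Metric.infDist_nonneg
  have hcs : ∀ j, 1 ≤ ‖csinc ((2 * exp 1 / r : ℝ) * (z j - (rePart z j : ℂ)))‖ := by
    intro j
    refine one_le_norm_csinc ?_
    rw [hzre, Complex.re_ofReal_mul]
    simp
  rw [localBlock, logCombination, if_pos]
  · rw [EReal.coe_le_coe_iff]
    simp only [Fintype.sum_sum_type, Sum.elim_inl, Sum.elim_inr, one_mul, ← hr, hφarg]
    have h1 : 0 ≤ ∑ j, t * (B * r)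
        * log ‖csinc ((2 * exp 1 / r : ℝ) * (z j - (rePart z j : ℂ)))‖ :=
      Finset.sum_nonneg fun j _ => mul_nonneg (by positivity) (log_nonneg (hcs j))
    have h2 : ∑ j, 1 / 2 * β (2 * (B₀ * |A₀ / A * imPart z j - s|))
        ≤ k / 4 * β (4 * (A₀ * B₀ / A) * ‖imPart z‖) + k / 4 * β (4 * (B₀ * |s|)) := by
      calc _ ≤ ∑ _j : Fin k, (1 / 4 * β (4 * (A₀ * B₀ / A) * ‖imPart z‖)
            + 1 / 4 * β (4 * (B₀ * |s|))) := by
            refine Finset.sum_le_sum fun j _ => ?_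
            have h3 := map_add_le_half hβconv (s := 2 * (A₀ * B₀ / A) * ‖imPart z‖)
              (t := 2 * (B₀ * |s|)) (by positivity) (by positivity)
            rw [show 2 * (2 * (A₀ * B₀ / A) * ‖imPart z‖) = 4 * (A₀ * B₀ / A) * ‖imPart z‖ by ring,
              show 2 * (2 * (B₀ * |s|)) = 4 * (B₀ * |s|) by ring] at h3
            have hy : |imPart z j| ≤ ‖imPart z‖ := norm_le_pi_norm (imPart z) j
            have h4 : β (2 * (B₀ * |A₀ / A * imPart z j - s|))
                ≤ β (2 * (A₀ * B₀ / A) * ‖imPart z‖ + 2 * (B₀ * |s|)) := by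
              refine hβm (Set.mem_Ici.2 (by positivity)) (Set.mem_Ici.2 (by positivity)) ?_
              have h5 : |A₀ / A * imPart z j - s| ≤ A₀ / A * ‖imPart z‖ + |s| := by
                refine (abs_sub _ _).trans (add_le_add_left ?_ _)
                rw [abs_mul, abs_of_pos (by positivity : 0 < A₀ / A)]
                gcongr
              calc 2 * (B₀ * |A₀ / A * imPart z j - s|)
                  ≤ 2 * (B₀ * (A₀ / A * ‖imPart z‖ + |s|)) := by gcongr
                _ = _ := by ring
            linarith
        _ = _ := by simp; ring
    simp only [rho, Finset.sum_const, Finset.card_univ, Fintype.card_fin, nsmul_eq_mul, ← hr]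
    linarith
  · rintro (j | j)
    · exact norm_pos_iff.1 (zero_lt_one.trans_le (hcs j))
    · simpa only [Sum.elim_inr, hφarg] using hs

/-! ### The supremum of the blocks. -/

/-- Plurisubharmonic functions between `ρ_{U,A,B} - H` over `X` and `ρ_{U,A',B'}`, with `H`
independent of the set `X`, for `α` and `β` that vanish at zero. -/
theorem exists_isPlurisubharmonic_between {k : ℕ} {α β : ℝ → ℝ} {U : Set (Fin k → ℝ)}
    (hUne : U.Nonempty) {A B A₀ B₀ A' B' : ℝ} (hA : 0 < A) (hB : 0 < B) (hA₀ : 0 < A₀)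
    (hB₀ : 0 < B₀) (hA' : 0 < A') (hαc : ContinuousOn α (Set.Ici 0))
    (hαm : MonotoneOn α (Set.Ici 0)) (hα0 : α 0 = 0)
    (hαA : ∀ a b, 0 ≤ a → 0 ≤ b → α ((a + b) / A') ≤ α (a / A) + α (b / A))
    (hβc : ContinuousOn β (Set.Ici 0)) (hβm : MonotoneOn β (Set.Ici 0))
    (hβconv : ConvexOn ℝ (Set.Ici 0) β) (hβ0 : β 0 = 0) {φ : ℂ → ℂ} (hφ : Differentiable ℂ φ)
    (hφ0 : φ ≠ 0) (hφb : ∀ z : ℂ, ‖φ z‖ ≤ Real.exp (β (B₀ * |z.im|) - α (|z.re| / A₀)))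
    (hB' : B' = (2 * Real.exp 1 * k + 1) * B + 4 * k * A₀ * B₀ / A) (C : ℝ) :
    ∃ H : ℝ, ∀ X : Set (Fin k → ℝ), ∃ ρ : (Fin k → ℂ) → EReal, IsPlurisubharmonic ρ ∧
      (∀ M, (∀ ξ ∈ X, Metric.infDist ξ U ≤ M) → ∀ z,
        ρ z ≤ ((rho α β Set.univ A' B' z + β (2 * B * M) + C : ℝ) : EReal)) ∧
      (∀ z, ρ z ≤ ((rho α β U A' B' z + C : ℝ) : EReal)) ∧
      ∀ z, rePart z ∈ X → ((rho α β U A B z - H : ℝ) : EReal) ≤ ρ z := by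
  -- Over `Re z = ξ` the arguments of `φ` are purely imaginary, so the nonzero value must be found
  -- on that axis.
  obtain ⟨s, hs⟩ := exists_ne_zero_on_imaginary_axis hφ hφ0
  have hB'0 : 0 ≤ B' := by rw [hB']; positivity
  have hsubgr : ∀ ξ : Fin k → ℝ, ∃ t, 0 ≤ t ∧ ∀ u, 0 ≤ u →
      β (B * Metric.infDist ξ U) + t * (u - B * Metric.infDist ξ U) ≤ β u := fun ξ =>
    exists_subgradient hβm hβconv (mul_nonneg hB.le Metric.infDist_nonneg)
  choose t ht hsub using hsubgr
  refine ⟨k / 4 * β (4 * (B₀ * |s|)) - k * log ‖φ (s * Complex.I)‖ - C, fun X => ?_⟩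
  set F : X × (Fin k → ℝ) → (Fin k → ℂ) → EReal := fun i =>
    localBlock α β U A B A₀ B₀ φ (t i.1) C i.1 i.2 with hF
  have hFle := fun (i : X × (Fin k → ℝ)) z => localBlock_le (C := C) hUne hA hB hA₀ hB₀ hA' hαm hα0
    hαA hβm hβconv hβ0 hφb hB' (ht i.1) i.1 i.2 (hsub i.1) z
  have hcont : ∀ V : Set (Fin k → ℝ), Continuous (rho α β V A' B') := fun V =>
    continuous_rho hαc hβc V hA'.le hB'0
  have hle : ∀ z, ⨆ i, F i z ≤ ((rho α β U A' B' z + C : ℝ) : EReal) := fun z =>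
    iSup_le fun i => (hFle i z).1
  have hmean : SubMean fun z => ⨆ i, F i z := SubMean.iSup fun i =>
    subMean_localBlock U hA hB hA₀ hB₀ hβc hβm hβconv hφ (ht i.1) C i.1 i.2
  refine ⟨uscReg fun z => ⨆ i, F i z,
    hmean.isPlurisubharmonic_uscReg ((hcont U).add continuous_const) hle, fun M hM => ?_, ?_,
    fun z hz => ?_⟩
  · exact uscReg_le (continuous_coe_real_ereal.comp
        (((hcont Set.univ).add continuous_const).add continuous_const)).upperSemicontinuous
      fun z => iSup_le fun i => (hFle i z).2 M (hM i.1 i.1.2)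
  · exact uscReg_le (continuous_coe_real_ereal.comp
        ((hcont U).add continuous_const)).upperSemicontinuous hle
  · refine le_trans ?_ (le_uscReg _ z)
    exact (le_localBlock U hA hB hA₀ hB₀ hβm hβconv hs C (ht (rePart z)) z).trans
      (le_iSup (fun i => F i z) (⟨rePart z, hz⟩, fun j => A₀ / A * imPart z j - s))

/-- The distance to a cone is at most the distance to the origin. -/
theorem IsCone.infDist_le_norm {k : ℕ} {U : Set (Fin k → ℝ)} (hU : IsCone U) (hUne : U.Nonempty)
    (x : Fin k → ℝ) : Metric.infDist x U ≤ ‖x‖ := by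
  obtain ⟨u, hu⟩ := hUne
  have h0 : (0 : Fin k → ℝ) ∈ closure U := by
    have ht : Tendsto (fun t : ℝ => t • u) (𝓝[>] 0) (𝓝 0) := by
      have : Continuous fun t : ℝ => t • u := by fun_prop
      simpa using (this.tendsto 0).mono_left nhdsWithin_le_nhds
    refine mem_closure_of_tendsto ht ?_
    filter_upwards [self_mem_nhdsWithin] with t ht
    exact hU u hu t ht
  rw [← Metric.infDist_closure]
  simpa using Metric.infDist_le_dist_of_mem (x := x) h0

end PshApprox

end

/-! ### Reduction to `α 0 = β 0 = 0` and conclusion. -/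

theorem theorem3 (k : ℕ) (A B A₀ B₀ : ℝ) (hA : 0 < A) (hB : 0 < B) (hA₀ : 0 < A₀) (hB₀ : 0 < B₀)
    (U : Set (Fin k → ℝ)) (hU : PshApprox.IsCone U) (hUne : U.Nonempty)
    (α β : ℝ → ℝ)
    (hαc : ContinuousOn α (Set.Ici 0)) (hαm : MonotoneOn α (Set.Ici 0))
    (hβc : ContinuousOn β (Set.Ici 0)) (hβm : MonotoneOn β (Set.Ici 0))
    (hβconv : ConvexOn ℝ (Set.Ici 0) β)
    (φ : ℂ → ℂ) (hφ : Differentiable ℂ φ) (hφ0 : φ ≠ 0)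
    (hφb : ∀ z : ℂ, ‖φ z‖ ≤ Real.exp (β (B₀ * |z.im|) - α (|z.re| / A₀)))
    (A' B' : ℝ) (hA' : A' = 2 * A ∨ (ConcaveOn ℝ (Set.Ici 0) α ∧ A' = A))
    (hB' : B' = (2 * Real.exp 1 * k + 1) * B + 4 * k * A₀ * B₀ / A) :
    (∃ H : ℝ, ∀ R : ℝ, 0 < R →
      ∃ ρR : (Fin k → ℂ) → EReal, PshApprox.IsPlurisubharmonic ρR ∧
        (∀ z, ρR z ≤
          ((PshApprox.rho α β Set.univ A' B' z + β (2 * B * Real.exp 1 * R) : ℝ) : EReal)) ∧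
        (∀ z, ρR z ≤ ((PshApprox.rho α β U A' B' z : ℝ) : EReal)) ∧
        (∀ z, ‖PshApprox.rePart z‖ ≤ R →
          ((PshApprox.rho α β U A B z - H : ℝ) : EReal) ≤ ρR z)) ∧
    (∃ H : ℝ, ∃ ρ : (Fin k → ℂ) → EReal, PshApprox.IsPlurisubharmonic ρ ∧
      ∀ z, ((PshApprox.rho α β U A B z - H : ℝ) : EReal) ≤ ρ z ∧
        ρ z ≤ ((PshApprox.rho α β U A' B' z : ℝ) : EReal)) := by
  have hA'pos : 0 < A' := by rcases hA' with h | ⟨-, h⟩ <;> rw [h] <;> positivity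
  set α₁ : ℝ → ℝ := fun s => α s - α 0 with hα₁
  set β₁ : ℝ → ℝ := fun s => β s - β 0 with hβ₁
  set φ₁ : ℂ → ℂ := fun z => (Real.exp (α 0 - β 0) : ℂ) * φ z with hφ₁
  have hα₁c : ContinuousOn α₁ (Set.Ici 0) := hαc.sub continuousOn_const
  have hβ₁c : ContinuousOn β₁ (Set.Ici 0) := hβc.sub continuousOn_const
  have hα₁m : MonotoneOn α₁ (Set.Ici 0) := fun a ha b hb h => sub_le_sub_right (hαm ha hb h) _
  have hβ₁m : MonotoneOn β₁ (Set.Ici 0) := fun a ha b hb h => sub_le_sub_right (hβm ha hb h) _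
  have hβ₁conv : ConvexOn ℝ (Set.Ici 0) β₁ := by
    simpa [hβ₁, sub_eq_add_neg] using! hβconv.add_const (-β 0)
  have hα₁nn : ∀ s, 0 ≤ s → 0 ≤ α₁ s := fun s hs => by
    simpa [hα₁] using hαm (Set.mem_Ici.2 le_rfl) hs hs
  have hα₁A : ∀ a b, 0 ≤ a → 0 ≤ b → α₁ ((a + b) / A') ≤ α₁ (a / A) + α₁ (b / A) := by
    intro a b ha hb
    rcases hA' with h | ⟨hconc, h⟩
    · rcases le_total a b with hab | hab
      · have h1 : α₁ ((a + b) / A') ≤ α₁ (b / A) := by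
          refine hα₁m (Set.mem_Ici.2 (by positivity)) (Set.mem_Ici.2 (by positivity)) ?_
          rw [h, div_le_div_iff₀ (by positivity) hA]
          nlinarith
        have := hα₁nn (a / A) (by positivity)
        linarith
      · have h1 : α₁ ((a + b) / A') ≤ α₁ (a / A) := by
          refine hα₁m (Set.mem_Ici.2 (by positivity)) (Set.mem_Ici.2 (by positivity)) ?_
          rw [h, div_le_div_iff₀ (by positivity) hA]
          nlinarith
        have := hα₁nn (b / A) (by positivity)
        linarith
    -- A concave function vanishing at 0 is subadditive on the half-line.
    · have hconv : ConvexOn ℝ (Set.Ici 0) fun s => -α₁ s := by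
        refine (hconc.neg.add_const (α 0)).congr fun s _ => ?_
        simp only [hα₁, Pi.add_apply, Pi.neg_apply]
        ring
      have := PshApprox.map_add_map_le hconv (by simp [hα₁]) (s := a / A) (t := b / A)
        (by positivity) (by positivity)
      rw [h, add_div]
      linarith
  have hφ₁d : Differentiable ℂ φ₁ := (differentiable_const _).mul hφ
  have hφ₁0 : φ₁ ≠ 0 := by
    intro h
    refine hφ0 (funext fun z => ?_)
    have := congrFun h z
    simpa [hφ₁] using this
  have hφ₁b : ∀ z : ℂ, ‖φ₁ z‖ ≤ Real.exp (β₁ (B₀ * |z.im|) - α₁ (|z.re| / A₀)) := by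
    intro z
    calc ‖φ₁ z‖ = Real.exp (α 0 - β 0) * ‖φ z‖ := by
          rw [hφ₁, norm_mul, Complex.norm_real, Real.norm_of_nonneg (Real.exp_pos _).le]
      _ ≤ Real.exp (α 0 - β 0) * Real.exp (β (B₀ * |z.im|) - α (|z.re| / A₀)) :=
          mul_le_mul_of_nonneg_left (hφb z) (Real.exp_pos _).le
      _ = _ := by rw [← Real.exp_add]; congr 1; simp only [hα₁, hβ₁]; ring
  have hrho : ∀ V a b (z : Fin k → ℂ), PshApprox.rho α β V a b z
      = PshApprox.rho α₁ β₁ V a b z + (2 * β 0 - α 0) := by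
    intro V a b z
    simp only [PshApprox.rho, hα₁, hβ₁]
    ring
  obtain ⟨H, hH⟩ := PshApprox.exists_isPlurisubharmonic_between hUne hA hB hA₀ hB₀ hA'pos hα₁c
    hα₁m (sub_self _) hα₁A hβ₁c hβ₁m hβ₁conv (sub_self _) hφ₁d hφ₁0 hφ₁b hB'
    -- Undoing the normalization costs `2 * β 0 - α 0` in `rho`, and one further `β 0` in the bound
    -- containing `β (2 * B * R)`. The minimum fits both, whatever the sign of `β 0`.
    (min (2 * β 0 - α 0) (3 * β 0 - α 0))
  refine ⟨⟨H + (2 * β 0 - α 0), fun R hR => ?_⟩, H + (2 * β 0 - α 0), ?_⟩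
  · obtain ⟨ρ, hρ, h1, h2, h3⟩ := hH {x | ‖x‖ ≤ R}
    refine ⟨ρ, hρ, fun z => ?_, fun z => ?_, fun z hz => ?_⟩
    -- The cone property enters only here: 0 lies in the closure of `U`, so `δ_U ≤ R` on the ball of
    -- radius `R`.
    · refine (h1 R (fun ξ hξ => (hU.infDist_le_norm hUne ξ).trans hξ) z).trans
        (EReal.coe_le_coe_iff.2 ?_)
      have h4 : β (2 * B * R) ≤ β (2 * B * Real.exp 1 * R) := by
        refine hβm (Set.mem_Ici.2 (by positivity)) (Set.mem_Ici.2 (by positivity)) ?_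
        have : 1 ≤ Real.exp 1 := Real.one_le_exp zero_le_one
        have h5 : 0 ≤ 2 * B * R := by positivity
        nlinarith
      have h6 := min_le_right (2 * β 0 - α 0) (3 * β 0 - α 0)
      rw [hrho]
      simp only [hβ₁] at h6 ⊢
      linarith
    · refine (h2 z).trans (EReal.coe_le_coe_iff.2 ?_)
      rw [hrho]
      linarith [min_le_left (2 * β 0 - α 0) (3 * β 0 - α 0)]
    · refine le_trans (EReal.coe_le_coe_iff.2 ?_) (h3 z hz)
      rw [hrho]
      linarith
  · obtain ⟨ρ, hρ, -, h2, h3⟩ := hH Set.univ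
    refine ⟨ρ, hρ, fun z => ⟨?_, ?_⟩⟩
    · refine le_trans (EReal.coe_le_coe_iff.2 ?_) (h3 z (Set.mem_univ _))
      rw [hrho]
      linarith
    · refine (h2 z).trans (EReal.coe_le_coe_iff.2 ?_)
      rw [hrho]
      linarith [min_le_left (2 * β 0 - α 0) (3 * β 0 - α 0)]
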